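/- Let $\log$ denote the natural logarithm on $(0,\infty)$, extended to nonzero complex numbers by its principal branch, $\log z=\ln|z|+i\arg z$ with $-\pi<\arg z\le\pi$ (so that $\log(-r)=\ln r+i\pi$ for $r>0$), and let $\zeta$ be the Riemann zeta function. Then the function $$x\longmapsto \frac{x\,\log (x)\,\log \left(x^2\right)\,\log \left(\log \left(x^2\right)\right)}{x^4-1}$$ (defined for $x>0$, $x\neq 1$) is Lebesgue integrable on $(0,\infty)$, and $$\int_{0}^{\infty}\frac{x \log (x)\, \log \left(x^2\right) \log \left(\log \left(x^2\right)\right)}{x^4-1}\,dx=-\frac{7}{16}\, i\, \pi\, \zeta (3).$$ -/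

import Mathlib

open MeasureTheory Set

/-! Substituting `x = exp t` turns the integrand into `t ^ 2 / sinh (2 * t) * log (2 * t)` on the
whole line (`exp_mul_integrand_exp`). The kernel is odd and `log |2 * t|` is even, so the real part
integrates to zero. The principal branch adds `π * I` exactly for `t < 0`, leaving `-π * I` times
the integral of the kernel over `t > 0`, which a series expansion evaluates
(`integral_Ioi_sq_div_sinh_two_mul`). -/

theorem mul_exp_le_sinh_two_mul {t : ℝ} (ht : 0 ≤ t) : t * Real.exp t ≤ Real.sinh (2 * t) := by
  rw [Real.sinh_two_mul]
  have h1 : t ≤ Real.sinh t := Real.self_le_sinh_iff.2 ht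
  have h2 : Real.exp t ≤ 2 * Real.cosh t := by
    rw [Real.cosh_eq]
    linarith [Real.exp_pos (-t)]
  calc t * Real.exp t ≤ Real.sinh t * (2 * Real.cosh t) :=
        mul_le_mul h1 h2 (Real.exp_pos t).le (ht.trans h1)
    _ = 2 * Real.sinh t * Real.cosh t := by ring

theorem abs_sq_div_sinh_two_mul_le (t : ℝ) :
    |t ^ 2 / Real.sinh (2 * t)| ≤ |t| * Real.exp (-|t|) := by
  rcases eq_or_ne t 0 with rfl | h0
  · simp
  have ht : 0 < |t| := abs_pos.2 h0
  rw [abs_div, Real.abs_sinh, abs_mul, abs_two, abs_pow]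
  have hpos : 0 < |t| * Real.exp |t| := by positivity
  calc |t| ^ 2 / Real.sinh (2 * |t|) ≤ |t| ^ 2 / (|t| * Real.exp |t|) := by
        gcongr
        exact mul_exp_le_sinh_two_mul ht.le
    _ = |t| * Real.exp (-|t|) := by
        rw [Real.exp_neg]
        field_simp

theorem abs_log_le_abs_add_inv {x : ℝ} (hx : x ≠ 0) : |Real.log x| ≤ |x| + |x|⁻¹ := by
  have hp : 0 < |x| := abs_pos.2 hx
  have hi : 0 < |x|⁻¹ := inv_pos.2 hp
  rw [← Real.log_abs, abs_le]
  constructor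
  · linarith [Real.one_sub_inv_le_log_of_pos hp]
  · linarith [Real.log_le_sub_one_of_pos hp]

/-- The factor `|t|` in the kernel bound absorbs the `|2 * t|⁻¹` that dominates the logarithm near
0. -/
theorem abs_sq_div_sinh_mul_log_le (t : ℝ) :
    |t ^ 2 / Real.sinh (2 * t) * Real.log (2 * t)| ≤ (2 * |t| ^ 2 + 1) * Real.exp (-|t|) := by
  rcases eq_or_ne t 0 with rfl | h0
  · simp
  have ht : 0 < |t| := abs_pos.2 h0
  rw [abs_mul]
  calc |t ^ 2 / Real.sinh (2 * t)| * |Real.log (2 * t)|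
      ≤ (|t| * Real.exp (-|t|)) * (|2 * t| + |2 * t|⁻¹) :=
        mul_le_mul (abs_sq_div_sinh_two_mul_le t) (abs_log_le_abs_add_inv (by positivity))
          (abs_nonneg _) (by positivity)
    _ = (2 * |t| ^ 2 + 1 / 2) * Real.exp (-|t|) := by
        rw [abs_mul, abs_two]
        field_simp
    _ ≤ _ := by gcongr; norm_num

theorem integrable_pow_abs_mul_exp_neg_abs (n : ℕ) :
    Integrable fun t : ℝ => |t| ^ n * Real.exp (-|t|) := by
  have h : IntegrableOn (fun t : ℝ => t ^ n * Real.exp (-t)) (Ioi 0) := by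
    refine (Real.GammaIntegral_convergent (s := n + 1) (by positivity)).congr_fun
      (fun t _ => ?_) measurableSet_Ioi
    simp [mul_comm]
  have hpos : IntegrableOn (fun t : ℝ => |t| ^ n * Real.exp (-|t|)) (Ioi 0) :=
    h.congr_fun (fun t ht => by simp [abs_of_pos (mem_Ioi.1 ht)]) measurableSet_Ioi
  have hneg : IntegrableOn (fun t : ℝ => |t| ^ n * Real.exp (-|t|)) (Iic 0) := by
    have hm : MeasurableEmbedding (Neg.neg : ℝ → ℝ) := (Homeomorph.neg ℝ).measurableEmbedding
    rw [← Measure.map_neg_eq_self (volume : Measure ℝ), hm.integrableOn_map_iff]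
    simpa [Function.comp_def, integrableOn_Ici_iff_integrableOn_Ioi] using hpos
  rw [← integrableOn_univ, ← Iic_union_Ioi (a := (0 : ℝ))]
  exact hneg.union hpos

theorem integrable_sq_div_sinh_two_mul : Integrable fun t : ℝ => t ^ 2 / Real.sinh (2 * t) := by
  refine (integrable_pow_abs_mul_exp_neg_abs 1).mono'
    (by fun_prop : Measurable _).aestronglyMeasurable (ae_of_all _ fun t => ?_)
  rw [pow_one]
  exact abs_sq_div_sinh_two_mul_le t

theorem integrable_sq_div_sinh_mul_log :
    Integrable fun t : ℝ => t ^ 2 / Real.sinh (2 * t) * Real.log (2 * t) := by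
  refine (((integrable_pow_abs_mul_exp_neg_abs 2).const_mul 2).add
    (integrable_pow_abs_mul_exp_neg_abs 0)).mono' 
    (integrable_sq_div_sinh_two_mul.aestronglyMeasurable.mul
      (by fun_prop : Measurable _).aestronglyMeasurable) (ae_of_all _ fun t => ?_)
  refine (abs_sq_div_sinh_mul_log_le t).trans_eq ?_
  simp only [Pi.add_apply]
  ring

theorem integral_eq_zero_of_odd {E : Type*} [NormedAddCommGroup E] [NormedSpace ℝ E] {f : ℝ → E}
    (hf : ∀ t, f (-t) = -f t) : ∫ t, f t = 0 := by
  have h := integral_neg_eq_self f volume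
  simp only [hf, integral_neg] at h
  have h2 : (2 : ℝ) • ∫ t, f t = 0 := by
    rw [two_smul]
    nth_rewrite 1 [← h]
    exact neg_add_cancel _
  exact (smul_eq_zero.1 h2).resolve_left two_ne_zero

theorem hasSum_one_div_odd_cube :
    HasSum (fun n : ℕ => 1 / (2 * (n : ℂ) + 1) ^ 3) (7 / 8 * riemannZeta 3) := by
  have hz : HasSum (fun n : ℕ => 1 / (n : ℂ) ^ 3) (riemannZeta 3) := by
    have h := zeta_nat_eq_tsum_of_gt_one (k := 3) (by norm_num)
    rw [Nat.cast_ofNat] at h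
    rw [h]
    refine Summable.hasSum ?_
    have := (Complex.summable_one_div_nat_cpow (p := 3)).2 (by norm_num)
    exact_mod_cast this
  have he : HasSum (fun n : ℕ => 1 / ((2 * n : ℕ) : ℂ) ^ 3) (1 / 8 * riemannZeta 3) := by
    refine (hz.mul_left (1 / 8)).congr_fun fun n => ?_
    push_cast
    rw [mul_pow]
    norm_num
    ring
  have hs : Summable fun n : ℕ => 1 / ((2 * n + 1 : ℕ) : ℂ) ^ 3 :=
    hz.summable.comp_injective (i := fun n : ℕ => 2 * n + 1) fun a b h => by simpa using h
  have h := (HasSum.even_add_odd (f := fun n : ℕ => 1 / (n : ℂ) ^ 3) he hs.hasSum).unique hz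
  have h' : ∑' n : ℕ, 1 / ((2 * n + 1 : ℕ) : ℂ) ^ 3 = 7 / 8 * riemannZeta 3 := by
    linear_combination h
  rw [← h']
  simpa using hs.hasSum

/-- Geometric series of ratio `exp (-4 * t)`. -/
theorem hasSum_exp_neg_odd_mul {t : ℝ} (ht : 0 < t) :
    HasSum (fun n : ℕ => 2 * Real.exp (-(2 * (2 * n + 1)) * t)) (1 / Real.sinh (2 * t)) := by
  have h1 : Real.exp (-(4 * t)) < 1 := by rw [Real.exp_lt_one_iff]; linarith
  have h := (hasSum_geometric_of_lt_one (Real.exp_pos _).le h1).mul_left (2 * Real.exp (-(2 * t)))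
  have hs : 0 < Real.sinh (2 * t) := Real.sinh_pos_iff.2 (by linarith)
  convert! h using 1
  · ext n
    rw [← Real.exp_nat_mul, mul_assoc, ← Real.exp_add]
    ring_nf
  · have h2 : 1 - Real.exp (-(4 * t)) ≠ 0 := by linarith
    rw [← div_eq_mul_inv, div_eq_div_iff hs.ne' h2, Real.sinh_eq,
      show -(4 * t) = -(2 * t) + -(2 * t) by ring, Real.exp_add]
    have h3 : Real.exp (-(2 * t)) * Real.exp (2 * t) = 1 := by rw [← Real.exp_add]; simp
    linear_combination -h3

/-- The integral is the Mellin transform of `1 / sinh (2 * t)` at `s = 3`. Termwise, each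
exponential gives `2 * Γ(3) / (2 * (2 * n + 1)) ^ 3`, which is half the reciprocal odd cube. -/
theorem integral_Ioi_sq_div_sinh_two_mul :
    ((∫ t : ℝ in Ioi 0, t ^ 2 / Real.sinh (2 * t) : ℝ) : ℂ) = 7 / 16 * riemannZeta 3 := by
  have h := hasSum_mellin (ι := ℕ) (a := fun _ => 2) (p := fun n => 2 * (2 * n + 1))
    (F := fun t => ((1 / Real.sinh (2 * t) : ℝ) : ℂ)) (s := 3)
    (fun n => Or.inr (by positivity)) (by norm_num)
    (fun t ht => by
      have := Complex.hasSum_ofReal.2 (hasSum_exp_neg_odd_mul ht)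
      simp at this ⊢; exact this) ?_
  · have h2 := (hasSum_one_div_odd_cube.mul_left (1 / 2)).unique (h.congr_fun fun n => ?_)
    · rw [show (7 / 16 : ℂ) * riemannZeta 3 = 1 / 2 * (7 / 8 * riemannZeta 3) by ring, h2, mellin,
        ← integral_complex_ofReal]
      refine setIntegral_congr_fun measurableSet_Ioi fun t _ => ?_
      simp only [show (3 : ℂ) - 1 = (2 : ℕ) by norm_num, Complex.cpow_natCast, smul_eq_mul]
      push_cast
      ring
    · have hn : (2 * (n : ℂ) + 1) ≠ 0 := by exact_mod_cast (by positivity : (2 * n + 1 : ℕ) ≠ 0)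
      have hG : Complex.Gamma 3 = 2 := by simp
      rw [hG, show (3 : ℂ) = (3 : ℕ) by norm_num, Complex.cpow_natCast]
      push_cast
      field_simp
  · have h3 := hasSum_one_div_odd_cube.summable.norm.mul_left (1 / 4)
    refine h3.congr fun n => ?_
    have hn : (0 : ℝ) < 2 * n + 1 := by positivity
    have : ‖(2 * (n : ℂ) + 1)‖ = 2 * n + 1 := by
      rw [show (2 * (n : ℂ) + 1) = ((2 * n + 1 : ℝ) : ℂ) by push_cast; rfl, Complex.norm_real,
        Real.norm_of_nonneg hn.le]
    rw [norm_div, norm_pow, this, show (3 : ℂ).re = (3 : ℕ) by norm_num, Real.rpow_natCast]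
    simp only [norm_one, Complex.norm_ofNat]
    field_simp
    norm_num

/-- `Real.log x` already means `log |x|`, so only the argument differs. -/
theorem clog_ofReal_eq_add_indicator (x : ℝ) :
    Complex.log x = Real.log x + (Iio (0 : ℝ)).indicator (fun _ => (Real.pi : ℂ) * Complex.I) x := by
  rw [Complex.log, Complex.norm_real, Real.norm_eq_abs, Real.log_abs]
  rcases lt_or_ge x 0 with hx | hx
  · rw [Complex.arg_ofReal_of_neg hx, indicator_of_mem (mem_Iio.2 hx)]
  · rw [Complex.arg_ofReal_of_nonneg hx, indicator_of_notMem (notMem_Iio.2 hx)]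
    simp

theorem exp_mul_integrand_exp (t : ℝ) :
    Real.exp t • (((Real.exp t : ℝ) : ℂ) * (Real.log (Real.exp t) : ℂ)
      * (Real.log (Real.exp t ^ 2) : ℂ) * Complex.log (Real.log (Real.exp t ^ 2) : ℂ)
        / (((Real.exp t : ℝ) : ℂ) ^ 4 - 1)) =
    ((t ^ 2 / Real.sinh (2 * t) * Real.log (2 * t) : ℝ) : ℂ) +
      (Iio (0 : ℝ)).indicator
        (fun t => (Real.pi : ℂ) * Complex.I * ((t ^ 2 / Real.sinh (2 * t) : ℝ) : ℂ)) t := by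
  have hlog : Real.log (Real.exp t ^ 2) = 2 * t := by
    rw [Real.log_pow, Real.log_exp, Nat.cast_ofNat]
  have hker : Real.exp t * (Real.exp t * t * (2 * t) / (Real.exp t ^ 4 - 1)) =
      t ^ 2 / Real.sinh (2 * t) := by
    -- At `t = 0`, that is `x = 1`, both quotients are 0 since division by zero gives 0.
    rcases eq_or_ne t 0 with rfl | ht
    · simp
    have hs : Real.sinh (2 * t) ≠ 0 := Real.sinh_ne_zero.2 (by positivity)
    have he : Real.exp t ^ 4 - 1 = 2 * Real.exp t ^ 2 * Real.sinh (2 * t) := by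
      rw [Real.sinh_eq, Real.exp_neg, show Real.exp (2 * t) = Real.exp t ^ 2 by
        rw [← Real.exp_nat_mul, Nat.cast_ofNat]]
      field_simp
    rw [he]
    have := Real.exp_pos t
    field_simp
  have hind : (Iio (0 : ℝ)).indicator (fun _ => (Real.pi : ℂ) * Complex.I) (2 * t) =
      (Iio (0 : ℝ)).indicator (fun _ => (Real.pi : ℂ) * Complex.I) t := by
    have h2t : 2 * t < 0 ↔ t < 0 := by constructor <;> intro h <;> linarith
    simp [indicator_apply, h2t]
  have hmul : (Iio (0 : ℝ)).indicator
      (fun t => (Real.pi : ℂ) * Complex.I * ((t ^ 2 / Real.sinh (2 * t) : ℝ) : ℂ)) t =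
      (Iio (0 : ℝ)).indicator (fun _ => (Real.pi : ℂ) * Complex.I) t *
        ((t ^ 2 / Real.sinh (2 * t) : ℝ) : ℂ) := by
    by_cases ht : t ∈ Iio (0 : ℝ) <;> simp [ht]
  rw [hlog, Real.log_exp, clog_ofReal_eq_add_indicator, hind, hmul, ← hker, Complex.real_smul]
  push_cast
  ring

theorem integrable_indicator_sq_div_sinh :
    Integrable ((Iio (0 : ℝ)).indicator
      (fun t : ℝ => (Real.pi : ℂ) * Complex.I * ((t ^ 2 / Real.sinh (2 * t) : ℝ) : ℂ))) :=
  (integrable_sq_div_sinh_two_mul.ofReal.const_mul _).indicator measurableSet_Iio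

theorem integral_Iio_sq_div_sinh_two_mul :
    ∫ t : ℝ in Iio 0, t ^ 2 / Real.sinh (2 * t) = -∫ t : ℝ in Ioi 0, t ^ 2 / Real.sinh (2 * t) := by
  rw [← integral_Iic_eq_integral_Iio, ← neg_zero, ← integral_comp_neg_Ioi, ← integral_neg, neg_zero]
  refine integral_congr_ae (ae_of_all _ fun t => ?_)
  simp [div_neg]

theorem mainTheorem11 :
    MeasureTheory.IntegrableOn
      (fun x : ℝ =>
        (x : ℂ) * (Real.log x : ℂ) * (Real.log (x ^ 2) : ℂ) * Complex.log (Real.log (x ^ 2) : ℂ)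
          / ((x : ℂ) ^ 4 - 1))
      (Set.Ioi (0 : ℝ)) ∧
    ∫ x : ℝ in Set.Ioi (0 : ℝ),
        (x : ℂ) * (Real.log x : ℂ) * (Real.log (x ^ 2) : ℂ) * Complex.log (Real.log (x ^ 2) : ℂ)
          / ((x : ℂ) ^ 4 - 1)
      = -(7 / 16 : ℂ) * Complex.I * (Real.pi : ℂ) * riemannZeta 3 := by
  have himg : Real.exp '' univ = Ioi 0 := by rw [image_univ, Real.range_exp]
  have hderiv : ∀ t ∈ univ, HasDerivWithinAt Real.exp (Real.exp t) univ t :=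
    fun t _ => (Real.hasDerivAt_exp t).hasDerivWithinAt
  have hinj : InjOn Real.exp univ := Real.exp_injective.injOn
  rw [← himg, integrableOn_image_iff_integrableOn_abs_deriv_smul MeasurableSet.univ hderiv hinj,
    integral_image_eq_integral_abs_deriv_smul MeasurableSet.univ hderiv hinj]
  simp only [Real.abs_exp, exp_mul_integrand_exp, integrableOn_univ, setIntegral_univ]
  have h1 : Integrable fun t : ℝ =>
      ((t ^ 2 / Real.sinh (2 * t) * Real.log (2 * t) : ℝ) : ℂ) :=
    integrable_sq_div_sinh_mul_log.ofReal
  have h2 := integrable_indicator_sq_div_sinh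
  refine ⟨h1.add h2, ?_⟩
  rw [integral_add h1 h2, integral_indicator measurableSet_Iio, integral_const_mul,
    integral_complex_ofReal, integral_complex_ofReal, integral_Iio_sq_div_sinh_two_mul, Complex.ofReal_neg,
    integral_Ioi_sq_div_sinh_two_mul, integral_eq_zero_of_odd]
  · rw [Complex.ofReal_zero]
    ring
  · intro t
    simp [div_neg, Real.log_neg_eq_log]
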